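/- Let $\mathcal S$ and $\mathcal A\neq\emptyset$ be finite sets of states and actions, $r:\mathcal S\times\mathcal A\to\mathbb R$ a reward $r(a|s)$, $0\le\gamma<1$ a discount factor and $\eta>0$. A policy is a family $\pi=(\pi(\cdot|s))_{s\in\mathcal S}$ of probability vectors on $\mathcal A$; $\Delta^\pi$ is the set of policies. A transition function is a family $q=(q(\cdot|a,s))_{s\in\mathcal S,a\in\mathcal A}$ of probability vectors on $\mathcal S$; write $q_s=(q(s'|a,s))_{a,s'}$. Let $\mathcal Q$ be a nonempty $(s)$-rectangular set of transition functions, i.e. $\mathcal Q=\prod_{s\in\mathcal S}\mathcal Q_s$, with every $\mathcal Q_s$ compact and convex. For sequences $\Pi=(\pi^0,\pi^1,\dots)$ in $\Delta^\pi$ and $Q=(q^0,q^1,\dots)$ of transition functions, and an initial state distribution $p$, put $$F_\infty(\Pi,Q)=\mathbb E_{\tau\sim(\Pi,Q),\,s_0\sim p}\Big[\sum_{t=0}^\infty\gamma^t\big(r(a_t|s_t)-\eta\ln\pi^t(a_t|s_t)\big)\Big],$$ where $a_t\sim\pi^t(\cdot|s_t)$ and $s_{t+1}\sim q^t(\cdot|a_t,s_t)$.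 For $V\in\mathbb R^{\mathcal S}$ let $z(a,s|V,q)=r(a|s)+\gamma\sum_{s'}q(s'|a,s)V(s')$, $$\psi_s(\pi,q,V)=\sum_a\pi(a|s)\big(z(a,s|V,q)-\eta\ln\pi(a|s)\big),\qquad \mathcal T[V](s)=\max_{\pi\in\Delta^\pi}\min_{q\in\mathcal Q}\psi_s(\pi,q,V),$$ with $0\ln 0=0$. Then: (0) For all $\Pi,Q,p$ the series in $F_\infty$ converges almost surely and its sum is integrable. (1) For all $V$ and $s$ the maximum and minimum in $\mathcal T[V](s)$ are attained and perfect duality holds: $\max_\pi\min_{q\in\mathcal Q}\psi_s(\pi,q,V)=\min_{q\in\mathcal Q}\max_\pi\psi_s(\pi,q,V)$. (2) $\mathcal T$ is a contraction of parameter $\gamma$ for the sup-norm and has a unique fixed point $V^*$. (3) For all $V$ and $s$ the function $q_s\mapsto\sum_a\exp(z(a,s|V,q)/\eta)$ is convex on $\mathcal Q_s$ and attains its minimum there. If $q\in\mathcal Q$ is such that $q_s$ is a minimizer for every $s$, then $\mathcal T[V](s)=\eta\ln\sum_a\exp(z(a,s|V,q)/\eta)$ for all $s$. (4) Let $q^*\in\mathcal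 Q$ be such that, for every $s$, $q^*_s$ minimizes $\sum_a\exp(z(a,s|V^*,q)/\eta)$ over $q_s\in\mathcal Q_s$, and let $$\pi^*(a|s)=\frac{\exp(z(a,s|V^*,q^*)/\eta)}{\sum_{a'}\exp(z(a',s|V^*,q^*)/\eta)}.$$ Then the mapping $V\mapsto\big(\eta\ln\sum_a\exp(z(a,s|V,q^*)/\eta)\big)_{s}$ is also a $\gamma$-contraction for the sup-norm whose unique fixed point is $V^*$; and for every $s$, $(\pi^*,q^*)$ is a saddle point of $\psi_s(\cdot,\cdot,V^*)$ over $\Delta^\pi\times\mathcal Q$, with value $V^*(s)$. (5) With $q^*,\pi^*$ as in (4), for every initial distribution $p$ the stationary policy $\pi^t=\pi^*$ is optimal for $\max_{\Pi}\min_{q^t\in\mathcal Q,\,t\ge0}F_\infty(\Pi,Q)$, the stationary choice $q^t=q^*$ is optimal for $\min_{q^t\in\mathcal Q,\,t\ge 0}\max_\Pi F_\infty(\Pi,Q)$, these two stationary sequences form a saddle point of $F_\infty$, and all maxima and minima are attained with $$\max_\Pi\min_{q^t\in\mathcal Q,\,t\ge0}F_\infty(\Pi,Q)=\min_{q^t\in\mathcal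 Q,\,t\ge0}\max_\Pi F_\infty(\Pi,Q)=\sum_s p(s)V^*(s).$$ In particular, for $s_0=s$ the common value is $V^*(s)$. -/

import Mathlib

open MeasureTheory ProbabilityTheory

/-! ### Max-min and min-max problems with attained optima -/

/-- `x` solves `max_x min_{y ∈ Y} f x y`, with optimal value `v`: every inner minimum exists, and
the outer maximum is attained at `x`. -/
def IsMaxMinAt {α β : Type*} (f : α → β → ℝ) (Y : Set β) (x : α) (v : ℝ) : Prop :=
  ∃ m : α → ℝ, (∀ x', IsLeast (f x' '' Y) (m x')) ∧ (∀ x', m x' ≤ m x) ∧ m x = v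

/-- `y` solves `min_{y ∈ Y} max_x f x y`, with optimal value `v`: every inner maximum exists, and
the outer minimum is attained at `y`. -/
def IsMinMaxAt {α β : Type*} (f : α → β → ℝ) (Y : Set β) (y : β) (v : ℝ) : Prop :=
  y ∈ Y ∧ ∃ M : β → ℝ, (∀ y' ∈ Y, IsGreatest (Set.range fun x => f x y') (M y')) ∧
    (∀ y' ∈ Y, M y ≤ M y') ∧ M y = v

/-- `max_x min_{y ∈ Y} f x y` exists and equals `v`. -/
def IsMaxMin {α β : Type*} (f : α → β → ℝ) (Y : Set β) (v : ℝ) : Prop :=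
  ∃ x, IsMaxMinAt f Y x v

/-- `min_{y ∈ Y} max_x f x y` exists and equals `v`. -/
def IsMinMax {α β : Type*} (f : α → β → ℝ) (Y : Set β) (v : ℝ) : Prop :=
  ∃ y, IsMinMaxAt f Y y v

/-- `(x, y)` with `y ∈ Y` is a saddle point of `f` (maximized in `x`, minimized in `y ∈ Y`). -/
def IsSaddle {α β : Type*} (f : α → β → ℝ) (Y : Set β) (x : α) (y : β) : Prop :=
  y ∈ Y ∧ (∀ x', f x' y ≤ f x y) ∧ (∀ y' ∈ Y, f x y ≤ f x y')

/-! ### Policies, transition probabilities, rectangularity -/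

/-- Randomized (one-stage) policies: `π s a` is the probability of action `a` in state `s`. -/
abbrev Policy (S A : Type*) [Fintype A] : Type _ :=
  {π : S → A → ℝ // ∀ s, π s ∈ stdSimplex ℝ A}

/-- Transition probabilities: `q s a s'` is the probability of moving to `s'` from `s` under the
action `a`. -/
abbrev Transition (S A : Type*) [Fintype S] : Type _ :=
  {q : S → A → S → ℝ // ∀ s a, q s a ∈ stdSimplex ℝ S}

/-- `𝒬` is `(s)`-rectangular with factors `Qs s`: it is the full product of the `Qs s` over all
states `s`. -/
def IsSRectangular {S A : Type*} [Fintype S] (𝒬 : Set (Transition S A))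
    (Qs : S → Set (A → S → ℝ)) : Prop :=
  Subtype.val '' 𝒬 = Set.univ.pi Qs

/-- Sequences `q⁰, q¹, …` of transition probabilities, all chosen from `𝒬`. -/
def adversarySeq {S A : Type*} [Fintype S] (𝒬 : Set (Transition S A)) :
    Set (ℕ → Transition S A) :=
  {Q | ∀ t, Q t ∈ 𝒬}

noncomputable section

/-! ### The law of the state-action trajectory and the infinite-horizon objective -/

lemma sum_ofReal_simplex {ι : Type*} [Fintype ι] (p : stdSimplex ℝ ι) :
    ∑ i, ENNReal.ofReal (p.1 i) = 1 := by
  rw [← ENNReal.ofReal_sum_of_nonneg (fun i _ => p.2.1 i), p.2.2, ENNReal.ofReal_one]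

/-- The probability mass function of a probability vector. -/
def simplexPMF {ι : Type*} [Fintype ι] (p : stdSimplex ℝ ι) : PMF ι :=
  PMF.ofFintype (fun i => ENNReal.ofReal (p.1 i)) (sum_ofReal_simplex p)

/-- Law of a pair `(s, a)` where `s` has law `p` and, given `s`, the action has law `π s`. -/
def stateActionPMF {S A : Type*} [Fintype S] [Fintype A] (p : stdSimplex ℝ S) (π : Policy S A) :
    PMF (S × A) :=
  (simplexPMF p).bind fun s => (simplexPMF ⟨π.1 s, π.2 s⟩).map fun a => (s, a)

/-- One-step kernel at time `t`: given the history up to time `t`, ending in `(s, a)`, the next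
state is drawn from `q^t(· | a, s)` and the next action from `π^{t+1}` at that state. -/
def stepKernel {S A : Type*} [Fintype S] [Fintype A]
    [MeasurableSpace S] [DiscreteMeasurableSpace S]
    [MeasurableSpace A] [DiscreteMeasurableSpace A]
    (pol : ℕ → Policy S A) (Q : ℕ → Transition S A) (t : ℕ) :
    Kernel ((_i : Finset.Iic t) → S × A) (S × A) :=
  Kernel.ofFunOfCountable fun h =>
    let x := h ⟨t, Finset.mem_Iic.2 le_rfl⟩
    (stateActionPMF ⟨(Q t).1 x.1 x.2, (Q t).2 x.1 x.2⟩ (pol (t + 1))).toMeasure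

instance {S A : Type*} [Fintype S] [Fintype A]
    [MeasurableSpace S] [DiscreteMeasurableSpace S]
    [MeasurableSpace A] [DiscreteMeasurableSpace A]
    (pol : ℕ → Policy S A) (Q : ℕ → Transition S A) (t : ℕ) :
    IsMarkovKernel (stepKernel pol Q t) :=
  ⟨fun _ => PMF.toMeasure.isProbabilityMeasure _⟩

/-- The law of the trajectory `(s₀, a₀), (s₁, a₁), …` with initial state distribution `p`, policies
`pol` and transition probabilities `Q`. -/
def trajLaw {S A : Type*} [Fintype S] [Fintype A]
    [MeasurableSpace S] [DiscreteMeasurableSpace S]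
    [MeasurableSpace A] [DiscreteMeasurableSpace A]
    (p : stdSimplex ℝ S) (pol : ℕ → Policy S A) (Q : ℕ → Transition S A) :
    Measure (ℕ → S × A) :=
  Kernel.trajMeasure (X := fun _ => S × A) (stateActionPMF p (pol 0)).toMeasure (stepKernel pol Q)

/-- The discounted entropy-regularized reward collected at time `t` along the trajectory `τ`. -/
def stageReward {S A : Type*} [Fintype A] (r : S → A → ℝ) (γ η : ℝ)
    (pol : ℕ → Policy S A) (τ : ℕ → S × A) (t : ℕ) : ℝ :=
  γ ^ t * r (τ t).1 (τ t).2 - γ ^ t * η * Real.log ((pol t).1 (τ t).1 (τ t).2)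

/-- The expected infinite-horizon discounted entropy-regularized reward `F_∞(pol, Q)`, started from
the initial state distribution `p` (`p` a point mass at `s` conditions on `s₀ = s`). -/
def expReward {S A : Type*} [Fintype S] [Fintype A]
    [MeasurableSpace S] [DiscreteMeasurableSpace S]
    [MeasurableSpace A] [DiscreteMeasurableSpace A]
    (r : S → A → ℝ) (γ η : ℝ) (p : stdSimplex ℝ S)
    (pol : ℕ → Policy S A) (Q : ℕ → Transition S A) : ℝ :=
  ∫ τ, ∑' t, stageReward r γ η pol τ t ∂(trajLaw p pol Q)

/-! ### Bellman operators -/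

/-- `ψ_s(π, q, V)`, the one-stage regularized reward plus discounted expected continuation. -/
def bellmanPsi {S A : Type*} [Fintype S] [Fintype A] (r : S → A → ℝ) (γ η : ℝ)
    (V : S → ℝ) (s : S) (π : Policy S A) (q : Transition S A) : ℝ :=
  ∑ a, π.1 s a * (r s a - η * Real.log (π.1 s a) + γ * ∑ s', q.1 s a s' * V s')

/-- The robust Bellman operator `T[V](s) = max_π min_{q ∈ 𝒬} ψ_s(π, q, V)`. -/
def robustBellman {S A : Type*} [Fintype S] [Fintype A] (r : S → A → ℝ) (γ η : ℝ)
    (𝒬 : Set (Transition S A)) (V : S → ℝ) (s : S) : ℝ :=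
  ⨆ π : Policy S A, ⨅ q : 𝒬, bellmanPsi r γ η V s π q.1

/-- `z(a, s | V, q)`, where only the component `x = q_s` of `q` matters. -/
def zValue {S A : Type*} [Fintype S] (r : S → A → ℝ) (γ : ℝ) (V : S → ℝ)
    (s : S) (x : A → S → ℝ) (a : A) : ℝ :=
  r s a + γ * ∑ s', x a s' * V s'

/-- `∑ₐ exp (z(a, s | V, q) / η)`, as a function of the component `x = q_s` of `q`. -/
def expSum {S A : Type*} [Fintype S] [Fintype A] (r : S → A → ℝ) (γ η : ℝ) (V : S → ℝ)
    (s : S) (x : A → S → ℝ) : ℝ :=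
  ∑ a, Real.exp (zValue r γ V s x a / η)

/-- `η ln ∑ₐ exp (z(a, s | V, q) / η)`. -/
def softBellman {S A : Type*} [Fintype S] [Fintype A] (r : S → A → ℝ) (γ η : ℝ)
    (q : Transition S A) (V : S → ℝ) (s : S) : ℝ :=
  η * Real.log (expSum r γ η V s (q.1 s))

lemma expSum_pos {S A : Type*} [Fintype S] [Fintype A] [Nonempty A] (r : S → A → ℝ) (γ η : ℝ)
    (V : S → ℝ) (s : S) (x : A → S → ℝ) : 0 < expSum r γ η V s x :=
  Finset.sum_pos (fun _ _ => Real.exp_pos _) Finset.univ_nonempty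

/-- The softmax policy
`π(a|s) = exp (z(a, s | V, q) / η) / ∑_{a'} exp (z(a', s | V, q) / η)`. -/
def softmaxPolicy {S A : Type*} [Fintype S] [Fintype A] [Nonempty A] (r : S → A → ℝ) (γ η : ℝ)
    (V : S → ℝ) (q : Transition S A) : Policy S A :=
  ⟨fun s a => Real.exp (zValue r γ V s (q.1 s) a / η) / expSum r γ η V s (q.1 s), fun s =>
    ⟨fun _ => div_nonneg (Real.exp_pos _).le (expSum_pos r γ η V s _).le, by
      rw [← Finset.sum_div]
      exact div_self (expSum_pos r γ η V s _).ne'⟩⟩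

/-- `q` lies in `𝒬` and, for each state `s`, its component `q_s` minimizes
`∑ₐ exp (z(a, s | V, ·) / η)` over `Qs s`. -/
def IsWorstCase {S A : Type*} [Fintype S] [Fintype A] (r : S → A → ℝ) (γ η : ℝ)
    (𝒬 : Set (Transition S A)) (Qs : S → Set (A → S → ℝ)) (V : S → ℝ)
    (q : Transition S A) : Prop :=
  q ∈ 𝒬 ∧ ∀ s, IsMinOn (expSum r γ η V s) (Qs s) (q.1 s)

end

/-! ### Saddle points and attained optima -/

/-! Fix `V` and `s`. For a fixed `q` the one-stage objective is linear in `π s` plus `η` times its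
entropy. By the Gibbs principle (`gibbs_le`, `gibbs_eq`) its maximum over policies is the soft
Bellman value, attained by the softmax policy. Minimizing that maximum over `q` amounts to
minimizing the convex function `expSum` over `Qs s`. No minimax theorem is needed. The first-order
condition at a minimizer (`expSum_variational`), divided by the partition function, says exactly
that the minimizer is a worst response to its own softmax policy. Hence the pair is a saddle point
(`IsWorstCase.isSaddle_bellmanPsi`), which yields duality and the closed form of the operator.
Replacing `V` by `W` moves `bellmanPsi` by at most `γ * ‖V - W‖`, so saddle inequalities give the
contraction, and Banach's theorem gives `V*`. Over the infinite horizon, the expected reward is a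
discounted series of stage means. Telescoping with `V*` (`sum_range_discounted_stageMean`) writes it
as `∑ p V*` plus discounted averages of `bellmanPsi - V*`. If one player uses the stationary saddle
strategy, these terms have a fixed sign whatever time-dependent sequence the other plays, so the
stationary pair is a saddle point (`isSaddle_expReward`). The remaining inner optima exist because
both sequence spaces are compact and the objective is continuous. -/

/-- The saddle inequalities alone identify the value at `x`; compactness and continuity serve to
attain the inner minimum at every other `x'`. -/
lemma IsSaddle.isMaxMinAt {α β : Type*} [TopologicalSpace β] {f : α → β → ℝ} {Y : Set β}
    {x : α} {y : β} (h : IsSaddle f Y x y) (hY : IsCompact Y) (hf : ∀ x', Continuous (f x')) :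
    IsMaxMinAt f Y x (f x y) := by
  have hmin (x' : α) : ∃ m, IsLeast (f x' '' Y) m :=
    (hY.image (hf x')).exists_isLeast ⟨_, Set.mem_image_of_mem _ h.1⟩
  choose m hm using hmin
  have hmx : m x = f x y := by
    refine (hm x).unique ⟨Set.mem_image_of_mem _ h.1, ?_⟩
    rintro _ ⟨y', hy', rfl⟩
    exact h.2.2 y' hy'
  refine ⟨m, hm, fun x' => ?_, hmx⟩
  rw [hmx]
  exact ((hm x').2 (Set.mem_image_of_mem _ h.1)).trans (h.2.1 x')

lemma IsSaddle.isMinMaxAt {α β : Type*} [TopologicalSpace α] [CompactSpace α] {f : α → β → ℝ}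
    {Y : Set β} {x : α} {y : β} (h : IsSaddle f Y x y) (hf : ∀ y', Continuous fun x => f x y') :
    IsMinMaxAt f Y y (f x y) := by
  have hmax (y' : β) : ∃ M, IsGreatest (Set.range fun x => f x y') M :=
    (isCompact_range (hf y')).exists_isGreatest ⟨_, Set.mem_range_self x⟩
  choose M hM using hmax
  have hMy : M y = f x y := by
    refine (hM y).unique ⟨Set.mem_range_self x, ?_⟩
    rintro _ ⟨x', rfl⟩
    exact h.2.1 x'
  refine ⟨h.1, M, fun y' _ => hM y', fun y' hy' => ?_, hMy⟩
  rw [hMy]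
  exact (h.2.2 y' hy').trans ((hM y').2 (Set.mem_range_self x))

/-- Real `⨆` and `⨅` take default values on unbounded families; attainment of the optima ensures
that they are genuine here. -/
lemma IsMaxMinAt.iSup_iInf_eq {α β : Type*} {f : α → β → ℝ} {Y : Set β} {x : α} {v : ℝ}
    (h : IsMaxMinAt f Y x v) : ⨆ x', ⨅ y : Y, f x' y = v := by
  obtain ⟨m, hm, hmax, rfl⟩ := h
  have hinf (x' : α) : ⨅ y : Y, f x' y = m x' := by
    rw [← sInf_image']
    exact (hm x').csInf_eq
  simp_rw [hinf]
  refine IsGreatest.csSup_eq ⟨Set.mem_range_self x, ?_⟩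
  rintro _ ⟨x', rfl⟩
  exact hmax x'

/-! ### Compactness of the sets of policies and of transition functions -/

instance {S A : Type*} [Fintype A] : CompactSpace (Policy S A) := by
  have h : IsCompact (Set.univ.pi fun _ : S => stdSimplex ℝ A) :=
    isCompact_univ_pi fun _ => isCompact_stdSimplex ℝ A
  have h' : {π : S → A → ℝ | ∀ s, π s ∈ stdSimplex ℝ A} = Set.univ.pi fun _ => stdSimplex ℝ A := by
    ext; simp
  rw [← h'] at h
  exact isCompact_iff_compactSpace.1 h

section Rectangular

variable {S A : Type*} [Fintype S] {𝒬 : Set (Transition S A)} {Qs : S → Set (A → S → ℝ)}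

lemma IsSRectangular.isCompact (hrect : IsSRectangular 𝒬 Qs) (hcompact : ∀ s, IsCompact (Qs s)) :
    IsCompact 𝒬 := by
  refine Topology.IsInducing.subtypeVal.isCompact_iff.2 ?_
  have h : IsCompact (Set.univ.pi Qs) := isCompact_univ_pi hcompact
  exact hrect.symm ▸ h

lemma IsSRectangular.component_mem (hrect : IsSRectangular 𝒬 Qs) {q : Transition S A}
    (hq : q ∈ 𝒬) (s : S) : q.1 s ∈ Qs s := by
  have h : q.1 ∈ Set.univ.pi Qs := hrect ▸ Set.mem_image_of_mem _ hq
  exact h s trivial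

lemma IsSRectangular.exists_eq (hrect : IsSRectangular 𝒬 Qs) {x : S → A → S → ℝ}
    (hx : ∀ s, x s ∈ Qs s) : ∃ q ∈ 𝒬, q.1 = x := by
  have h : x ∈ Subtype.val '' 𝒬 := by
    unfold IsSRectangular at hrect
    rw [hrect]
    exact fun s _ => hx s
  exact h

lemma isCompact_adversarySeq (h : IsCompact 𝒬) : IsCompact (adversarySeq 𝒬) := by
  have h' : adversarySeq 𝒬 = Set.univ.pi fun _ => 𝒬 := by
    ext; simp [adversarySeq]
  rw [h']
  exact isCompact_univ_pi fun _ => h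

end Rectangular

/-! ### The Gibbs variational principle -/

/-- This is `log t ≤ t - 1` at `t = y / x`, multiplied by `x`: the pointwise form of nonnegativity
of relative entropy. -/
lemma Real.mul_log_add_negMulLog_le {x y : ℝ} (hx : 0 ≤ x) (hy : 0 < y) :
    x * Real.log y + Real.negMulLog x ≤ y - x := by
  rcases hx.eq_or_lt with rfl | hx
  · simpa using hy.le
  · have h := Real.log_le_sub_one_of_pos (div_pos hy hx)
    rw [Real.log_div hy.ne' hx.ne'] at h
    have h2 := mul_le_mul_of_nonneg_left h hx.le
    rw [Real.negMulLog]
    have h3 : x * (y / x - 1) = y - x := by field_simp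
    linarith

lemma gibbs_le {ι : Type*} [Fintype ι] [Nonempty ι] {η : ℝ} (hη : 0 < η) (z : ι → ℝ)
    {x : ι → ℝ} (hx : x ∈ stdSimplex ℝ ι) :
    ∑ i, (x i * z i + η * Real.negMulLog (x i)) ≤ η * Real.log (∑ i, Real.exp (z i / η)) := by
  set Z := ∑ i, Real.exp (z i / η) with hZ
  have hZ0 : 0 < Z := Finset.sum_pos (fun _ _ => Real.exp_pos _) Finset.univ_nonempty
  -- The pointwise inequality is used with `y` the softmax weight. After summation the first term
  -- vanishes, since both vectors have mass 1.
  have key (i : ι) : x i * z i + η * Real.negMulLog (x i) ≤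
      η * (Real.exp (z i / η) / Z - x i) + x i * (η * Real.log Z) := by
    have h := Real.mul_log_add_negMulLog_le (hx.1 i) (div_pos (Real.exp_pos (z i / η)) hZ0)
    rw [Real.log_div (Real.exp_pos _).ne' hZ0.ne', Real.log_exp] at h
    have h2 := mul_le_mul_of_nonneg_left h hη.le
    have h3 : η * (x i * (z i / η - Real.log Z) + Real.negMulLog (x i)) =
        x i * z i + η * Real.negMulLog (x i) - x i * (η * Real.log Z) := by
      field_simp
      ring
    linarith
  refine (Finset.sum_le_sum fun i _ => key i).trans_eq ?_
  rw [Finset.sum_add_distrib, ← Finset.sum_mul, ← Finset.mul_sum, Finset.sum_sub_distrib, hx.2,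
    ← Finset.sum_div, ← hZ, div_self hZ0.ne']
  ring

lemma gibbs_eq {ι : Type*} [Fintype ι] [Nonempty ι] {η : ℝ} (hη : 0 < η) (z : ι → ℝ)
    {x : ι → ℝ} (hx : ∀ i, x i = Real.exp (z i / η) / ∑ i, Real.exp (z i / η)) :
    ∑ i, (x i * z i + η * Real.negMulLog (x i)) = η * Real.log (∑ i, Real.exp (z i / η)) := by
  set Z := ∑ i, Real.exp (z i / η) with hZ
  have hZ0 : 0 < Z := Finset.sum_pos (fun _ _ => Real.exp_pos _) Finset.univ_nonempty
  have key (i : ι) : x i * z i + η * Real.negMulLog (x i) = x i * (η * Real.log Z) := by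
    have h : Real.log (x i) = z i / η - Real.log Z := by
      rw [hx, Real.log_div (Real.exp_pos _).ne' hZ0.ne', Real.log_exp]
    rw [Real.negMulLog, h]
    field_simp
    ring
  have hsum : ∑ i, x i = 1 := by
    simp_rw [hx]
    rw [← Finset.sum_div, ← hZ, div_self hZ0.ne']
  simp_rw [key]
  rw [← Finset.sum_mul, hsum, one_mul]

/-! ### The one-stage problem -/

lemma zValue_combo {S A : Type*} [Fintype S] {r : S → A → ℝ} {γ : ℝ} (V : S → ℝ) (s : S)
    (x y : A → S → ℝ) (a : A) {b c : ℝ} (h : b + c = 1) :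
    zValue r γ V s (b • x + c • y) a = b * zValue r γ V s x a + c * zValue r γ V s y a := by
  have h' : ∑ s', (b • x + c • y) a s' * V s' =
      b * ∑ s', x a s' * V s' + c * ∑ s', y a s' * V s' := by
    rw [Finset.mul_sum, Finset.mul_sum, ← Finset.sum_add_distrib]
    refine Finset.sum_congr rfl fun s' _ => ?_
    simp only [Pi.add_apply, Pi.smul_apply, smul_eq_mul]
    ring
  rw [zValue, zValue, zValue, h']
  linear_combination -(r s a) * h

section OneStage

variable {S A : Type*} [Fintype S] [Fintype A] {r : S → A → ℝ} {γ η : ℝ}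

/-- Through `Real.negMulLog` the entropy is visibly continuous, even where an action has probability
0. -/
lemma bellmanPsi_eq (V : S → ℝ) (s : S) (π : Policy S A) (q : Transition S A) :
    bellmanPsi r γ η V s π q =
      ∑ a, (π.1 s a * zValue r γ V s (q.1 s) a + η * Real.negMulLog (π.1 s a)) := by
  refine Finset.sum_congr rfl fun a _ => ?_
  rw [zValue, Real.negMulLog]
  ring

lemma continuous_bellmanPsi (V : S → ℝ) (s : S) :
    Continuous fun x : Policy S A × Transition S A => bellmanPsi r γ η V s x.1 x.2 := by
  simp_rw [bellmanPsi_eq, zValue]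
  have h1 (a : A) : Continuous fun x : Policy S A × Transition S A => x.1.1 s a :=
    (continuous_apply_apply s a).comp (continuous_subtype_val.comp continuous_fst)
  have h2 (a : A) (s' : S) : Continuous fun x : Policy S A × Transition S A => x.2.1 s a s' :=
    (continuous_apply s').comp
      ((continuous_apply_apply s a).comp (continuous_subtype_val.comp continuous_snd))
  refine continuous_finsetSum _ fun a _ => ((h1 a).mul (continuous_const.add
    (continuous_const.mul (continuous_finsetSum _ fun s' _ => (h2 a s').mul continuous_const)))).add
    (continuous_const.mul (Real.continuous_negMulLog.comp (h1 a)))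

/-- Rewards and entropy are the same on both sides, and averaging against probability vectors cannot
enlarge the sup-norm difference. -/
lemma bellmanPsi_le_add (hγ0 : 0 ≤ γ) (V W : S → ℝ) (s : S) (π : Policy S A)
    (q : Transition S A) :
    bellmanPsi r γ η V s π q ≤ bellmanPsi r γ η W s π q + γ * ‖V - W‖ := by
  have hexp (a : A) : ∑ s', q.1 s a s' * V s' ≤ ∑ s', q.1 s a s' * W s' + ‖V - W‖ := by
    calc ∑ s', q.1 s a s' * V s' ≤ ∑ s', (q.1 s a s' * W s' + q.1 s a s' * ‖V - W‖) := by
          refine Finset.sum_le_sum fun s' _ => ?_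
          rw [← mul_add]
          refine mul_le_mul_of_nonneg_left ?_ ((q.2 s a).1 s')
          have h := (le_abs_self _).trans (norm_le_pi_norm (V - W) s')
          rw [Pi.sub_apply] at h
          linarith
      _ = _ := by rw [Finset.sum_add_distrib, ← Finset.sum_mul, (q.2 s a).2, one_mul]
  calc bellmanPsi r γ η V s π q
      ≤ ∑ a, (π.1 s a * (r s a - η * Real.log (π.1 s a) + γ * ∑ s', q.1 s a s' * W s')
          + π.1 s a * (γ * ‖V - W‖)) := by
        refine Finset.sum_le_sum fun a _ => ?_
        rw [← mul_add]
        refine mul_le_mul_of_nonneg_left ?_ ((π.2 s).1 a)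
        have h := mul_le_mul_of_nonneg_left (hexp a) hγ0
        linarith
    _ = _ := by
        rw [Finset.sum_add_distrib, ← Finset.sum_mul, (π.2 s).2, one_mul]
        rfl

lemma convexOn_expSum (V : S → ℝ) (s : S) {K : Set (A → S → ℝ)} (hK : Convex ℝ K) :
    ConvexOn ℝ K (expSum r γ η V s) := by
  refine ⟨hK, fun x _ y _ b c hb hc hbc => ?_⟩
  simp only [expSum, smul_eq_mul, Finset.mul_sum]
  rw [← Finset.sum_add_distrib]
  refine Finset.sum_le_sum fun a _ => ?_
  rw [zValue_combo V s x y a hbc, add_div, mul_div_assoc, mul_div_assoc]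
  exact convexOn_exp.2 (Set.mem_univ _) (Set.mem_univ _) hb hc hbc

lemma continuous_expSum (V : S → ℝ) (s : S) : Continuous (expSum (A := A) r γ η V s) := by
  unfold expSum zValue
  fun_prop

/-- First-order optimality for a minimizer of the convex function `expSum` over a convex set. -/
lemma expSum_variational {V : S → ℝ} {s : S} {K : Set (A → S → ℝ)} (hK : Convex ℝ K)
    (hη : 0 < η) {x y : A → S → ℝ} (hx : x ∈ K) (hy : y ∈ K)
    (hmin : IsMinOn (expSum r γ η V s) K x) :
    0 ≤ ∑ a, Real.exp (zValue r γ V s x a / η) *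
      (zValue r γ V s y a - zValue r γ V s x a) := by
  set d : A → ℝ := fun a => zValue r γ V s y a - zValue r γ V s x a with hd
  -- Since `zValue` is affine in the transition component, this is `expSum` along the segment from
  -- `x` to `y`.
  set f : ℝ → ℝ := fun t => ∑ a, Real.exp ((zValue r γ V s x a + t * d a) / η) with hf
  have hderiv : HasDerivAt f (∑ a, Real.exp (zValue r γ V s x a / η) * (d a / η)) 0 := by
    refine HasDerivAt.fun_sum fun a _ => ?_
    have h := ((((hasDerivAt_id (0 : ℝ)).mul_const (d a)).const_add
      (zValue r γ V s x a)).div_const η).exp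
    simpa using h
  have hmin' : IsMinOn f (Set.Icc 0 1) 0 := by
    intro t ht
    have hmem : (1 - t) • x + t • y ∈ K :=
      hK hx hy (by linarith [ht.2]) ht.1 (by ring)
    have h := hmin hmem
    simp only [Set.mem_ofPred_eq, expSum] at h
    simp only [Set.mem_ofPred_eq, hf, zero_mul, add_zero]
    refine h.trans_eq (Finset.sum_congr rfl fun a _ => ?_)
    rw [zValue_combo V s x y a (by ring)]
    congr 2
    simp only [hd]
    ring
  -- The minimum sits at an endpoint of `[0, 1]`, so only the derivative in the inward direction has
  -- a sign.
  have hcone : (1 : ℝ) ∈ posTangentConeAt (Set.Icc (0 : ℝ) 1) 0 := by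
    have h := sub_mem_posTangentConeAt_of_segment_subset
      (s := Set.Icc (0 : ℝ) 1) (x := 0) (y := 1) (by rw [segment_eq_Icc zero_le_one])
    simpa using h
  have h := hmin'.localize.hasFDerivWithinAt_nonneg
    hderiv.hasFDerivAt.hasFDerivWithinAt hcone
  simp only [ContinuousLinearMap.toSpanSingleton_apply, one_smul] at h
  have h2 := mul_nonneg hη.le h
  rw [Finset.mul_sum] at h2
  refine h2.trans_eq (Finset.sum_congr rfl fun a _ => ?_)
  simp only [hd]
  field_simp

/-! ### Worst-case transitions, the one-stage saddle point and the contraction bounds. -/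

variable {𝒬 : Set (Transition S A)} {Qs : S → Set (A → S → ℝ)}

/-- Rectangularity is what allows minimizers chosen separately in each state to be glued into one
element of `𝒬`. -/
lemma exists_isWorstCase (hne : 𝒬.Nonempty) (hrect : IsSRectangular 𝒬 Qs)
    (hcompact : ∀ s, IsCompact (Qs s)) (V : S → ℝ) : ∃ q, IsWorstCase r γ η 𝒬 Qs V q := by
  obtain ⟨q₀, hq₀⟩ := hne
  have h (s : S) : ∃ x ∈ Qs s, IsMinOn (expSum r γ η V s) (Qs s) x :=
    (hcompact s).exists_isMinOn ⟨_, hrect.component_mem hq₀ s⟩ (continuous_expSum V s).continuousOn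
  choose x hx hmin using h
  obtain ⟨q, hq, rfl⟩ := hrect.exists_eq hx
  exact ⟨q, hq, hmin⟩

variable [Nonempty A]

lemma bellmanPsi_le_softBellman (hη : 0 < η) (V : S → ℝ) (s : S) (π : Policy S A)
    (q : Transition S A) : bellmanPsi r γ η V s π q ≤ softBellman r γ η q V s := by
  rw [bellmanPsi_eq]
  exact gibbs_le hη _ (π.2 s)

lemma bellmanPsi_softmaxPolicy (hη : 0 < η) (V : S → ℝ) (s : S) (q : Transition S A) :
    bellmanPsi r γ η V s (softmaxPolicy r γ η V q) q = softBellman r γ η q V s := by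
  rw [bellmanPsi_eq]
  exact gibbs_eq hη _ fun _ => rfl

lemma softBellman_le_add (hγ0 : 0 ≤ γ) (hη : 0 < η) (q : Transition S A) (V W : S → ℝ) (s : S) :
    softBellman r γ η q V s ≤ softBellman r γ η q W s + γ * ‖V - W‖ := by
  rw [← bellmanPsi_softmaxPolicy hη V]
  exact (bellmanPsi_le_add hγ0 V W s _ q).trans
    (add_le_add_left (bellmanPsi_le_softBellman hη W s _ q) _)

lemma IsWorstCase.isSaddle_bellmanPsi (hη : 0 < η) (hrect : IsSRectangular 𝒬 Qs)
    (hconvex : ∀ s, Convex ℝ (Qs s)) {V : S → ℝ} {q : Transition S A}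
    (hq : IsWorstCase r γ η 𝒬 Qs V q) (s : S) :
    IsSaddle (bellmanPsi r γ η V s) 𝒬 (softmaxPolicy r γ η V q) q := by
  refine ⟨hq.1, fun π => ?_, fun q' hq' => ?_⟩
  · rw [bellmanPsi_softmaxPolicy hη]
    exact bellmanPsi_le_softBellman hη V s π q
  · have h := expSum_variational (hconvex s) hη (hrect.component_mem hq.1 s)
      (hrect.component_mem hq' s) (hq.2 s)
    -- Dividing by the partition function turns the exponential weights into softmax probabilities.
    -- The entropy terms cancel in the difference because the policy is the same on both sides.
    have h2 := div_nonneg h (expSum_pos r γ η V s (q.1 s)).le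
    rw [bellmanPsi_eq, bellmanPsi_eq, ← sub_nonneg, ← Finset.sum_sub_distrib]
    rw [Finset.sum_div] at h2
    refine h2.trans_eq (Finset.sum_congr rfl fun a _ => ?_)
    simp only [softmaxPolicy]
    ring

lemma IsWorstCase.isMaxMinAt_bellmanPsi (hη : 0 < η) (hrect : IsSRectangular 𝒬 Qs)
    (hcompact : ∀ s, IsCompact (Qs s)) (hconvex : ∀ s, Convex ℝ (Qs s)) {V : S → ℝ}
    {q : Transition S A} (hq : IsWorstCase r γ η 𝒬 Qs V q) (s : S) :
    IsMaxMinAt (bellmanPsi r γ η V s) 𝒬 (softmaxPolicy r γ η V q) (softBellman r γ η q V s) := by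
  rw [← bellmanPsi_softmaxPolicy hη]
  exact (hq.isSaddle_bellmanPsi hη hrect hconvex s).isMaxMinAt (hrect.isCompact hcompact)
    fun π => (continuous_bellmanPsi V s).comp (Continuous.prodMk_right π)

lemma IsWorstCase.isMinMaxAt_bellmanPsi (hη : 0 < η) (hrect : IsSRectangular 𝒬 Qs)
    (hconvex : ∀ s, Convex ℝ (Qs s)) {V : S → ℝ}
    {q : Transition S A} (hq : IsWorstCase r γ η 𝒬 Qs V q) (s : S) :
    IsMinMaxAt (bellmanPsi r γ η V s) 𝒬 q (softBellman r γ η q V s) := by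
  rw [← bellmanPsi_softmaxPolicy hη]
  exact (hq.isSaddle_bellmanPsi hη hrect hconvex s).isMinMaxAt
    fun q' => (continuous_bellmanPsi V s).comp (Continuous.prodMk_left q')

lemma IsWorstCase.robustBellman_eq (hη : 0 < η) (hrect : IsSRectangular 𝒬 Qs)
    (hcompact : ∀ s, IsCompact (Qs s)) (hconvex : ∀ s, Convex ℝ (Qs s)) {V : S → ℝ}
    {q : Transition S A} (hq : IsWorstCase r γ η 𝒬 Qs V q) :
    robustBellman r γ η 𝒬 V = softBellman r γ η q V :=
  funext fun s => (hq.isMaxMinAt_bellmanPsi hη hrect hcompact hconvex s).iSup_iInf_eq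

lemma robustBellman_le_add (hγ0 : 0 ≤ γ) (hη : 0 < η) (hne : 𝒬.Nonempty)
    (hrect : IsSRectangular 𝒬 Qs) (hcompact : ∀ s, IsCompact (Qs s))
    (hconvex : ∀ s, Convex ℝ (Qs s)) (V W : S → ℝ) (s : S) :
    robustBellman r γ η 𝒬 V s ≤ robustBellman r γ η 𝒬 W s + γ * ‖V - W‖ := by
  obtain ⟨qV, hV⟩ := exists_isWorstCase (r := r) (γ := γ) (η := η) hne hrect hcompact V
  obtain ⟨qW, hW⟩ := exists_isWorstCase (r := r) (γ := γ) (η := η) hne hrect hcompact W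
  rw [hV.robustBellman_eq hη hrect hcompact hconvex, hW.robustBellman_eq hη hrect hcompact hconvex,
    ← bellmanPsi_softmaxPolicy hη V]
  -- The two optimizers are crossed: the policy optimal for `V` faces the transition worst for `W`.
  -- The saddle inequality for `V` bounds from one side, the Gibbs bound for `W` from the other.
  refine ((hV.isSaddle_bellmanPsi hη hrect hconvex s).2.2 qW hW.1).trans ?_
  exact (bellmanPsi_le_add hγ0 V W s _ qW).trans
    (add_le_add_left (bellmanPsi_le_softBellman hη W s _ qW) _)

end OneStage

/-! ### Sup-norm contractions -/

section Contraction

variable {S : Type*} [Fintype S] {γ : ℝ} {T : (S → ℝ) → S → ℝ}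

/-- A one-sided bound suffices, because `V` and `W` can be exchanged. -/
lemma norm_sub_le_of_le_add (hγ0 : 0 ≤ γ) (h : ∀ V W s, T V s ≤ T W s + γ * ‖V - W‖)
    (V W : S → ℝ) : ‖T V - T W‖ ≤ γ * ‖V - W‖ := by
  refine (pi_norm_le_iff_of_nonneg (mul_nonneg hγ0 (norm_nonneg _))).2 fun s => ?_
  rw [Pi.sub_apply, Real.norm_eq_abs, abs_sub_le_iff]
  have h1 := h V W s
  have h2 := h W V s
  rw [norm_sub_rev] at h2
  constructor <;> linarith

lemma exists_fixedPoint_iff (hγ0 : 0 ≤ γ) (hγ1 : γ < 1)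
    (h : ∀ V W, ‖T V - T W‖ ≤ γ * ‖V - W‖) : ∃ Vs, ∀ V, T V = V ↔ V = Vs := by
  have hT : ContractingWith ⟨γ, hγ0⟩ T := by
    refine ⟨by exact_mod_cast hγ1, LipschitzWith.of_dist_le_mul fun V W => ?_⟩
    rw [dist_eq_norm, dist_eq_norm]
    exact h V W
  exact ⟨hT.fixedPoint T, fun V => ⟨fun hV => hT.fixedPoint_unique hV,
    fun hV => hV ▸ hT.fixedPoint_isFixedPt⟩⟩

end Contraction
/-! ### Almost sure summability -/

/-- By Tonelli, the sum of the absolute values has finite integral, hence is finite almost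
everywhere and dominates the series. -/
lemma MeasureTheory.ae_summable_and_integrable_tsum {Ω ι : Type*} [Countable ι]
    {mΩ : MeasurableSpace Ω} {μ : Measure Ω} {F : ι → Ω → ℝ} (hF : ∀ i, Integrable (F i) μ)
    (hsum : Summable fun i => ∫ ω, ‖F i ω‖ ∂μ) :
    (∀ᵐ ω ∂μ, Summable fun i => F i ω) ∧ Integrable (fun ω => ∑' i, F i ω) μ := by
  have hmeas (i : ι) : AEMeasurable (fun ω => ‖F i ω‖ₑ) μ := (hF i).1.enorm
  have hlt : ∑' i, ∫⁻ ω, ‖F i ω‖ₑ ∂μ < ⊤ := by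
    have h (i : ι) : ∫⁻ ω, ‖F i ω‖ₑ ∂μ = ENNReal.ofReal (∫ ω, ‖F i ω‖ ∂μ) :=
      (ofReal_integral_norm_eq_lintegral_enorm (hF i)).symm
    simp_rw [h]
    exact hsum.tsum_ofReal_lt_top
  have hae : ∀ᵐ ω ∂μ, ∑' i, ‖F i ω‖ₑ < ⊤ := by
    refine ae_lt_top' (AEMeasurable.tsum hmeas) ?_
    rw [lintegral_tsum hmeas]
    exact hlt.ne
  have hsummable : ∀ᵐ ω ∂μ, Summable fun i => F i ω := by
    filter_upwards [hae] with ω hω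
    refine Summable.of_norm ?_
    simpa only [toReal_enorm] using ENNReal.summable_toReal hω.ne
  refine ⟨hsummable, ?_, ?_⟩
  · have h1 : AEMeasurable (fun ω => ∑' i, F i ω) μ :=
      AEMeasurable.tsum fun i => (hF i).1.aemeasurable
    exact h1.aestronglyMeasurable
  · refine lt_of_le_of_lt (lintegral_mono fun ω => enorm_tsum_le_tsum_enorm) ?_
    rw [lintegral_tsum hmeas]
    exact hlt

/-! ### Marginals of the law of the trajectory -/

section Occupancy

variable {S A : Type*} [Fintype S] [Fintype A]

noncomputable section

/-- One step of the controlled Markov chain on state distributions. -/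
def pushState (d : S → ℝ) (π : Policy S A) (q : Transition S A) (s' : S) : ℝ :=
  ∑ s, d s * ∑ a, π.1 s a * q.1 s a s'

/-- The distribution of the state at time `t`. -/
def stateDist (p : stdSimplex ℝ S) (pol : ℕ → Policy S A) (Q : ℕ → Transition S A) : ℕ → S → ℝ
  | 0 => p.1
  | t + 1 => pushState (stateDist p pol Q t) (pol t) (Q t)

/-- The expected regularized reward at time `t`, before discounting. -/
def stageMean (r : S → A → ℝ) (η : ℝ) (p : stdSimplex ℝ S) (pol : ℕ → Policy S A)
    (Q : ℕ → Transition S A) (t : ℕ) : ℝ :=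
  ∑ s, stateDist p pol Q t s * ∑ a, (pol t).1 s a * (r s a - η * Real.log ((pol t).1 s a))

end

/-- Duality between moving a distribution forward and averaging a function backward; it drives both
the marginal computation and the telescoping. -/
lemma sum_pushState_mul (d : S → ℝ) (π : Policy S A) (q : Transition S A) (V : S → ℝ) :
    ∑ s', pushState d π q s' * V s' =
      ∑ s, d s * ∑ a, π.1 s a * ∑ s', q.1 s a s' * V s' := by
  simp only [pushState, Finset.sum_mul, Finset.mul_sum]
  rw [Finset.sum_comm]
  refine Finset.sum_congr rfl fun s _ => ?_
  rw [Finset.sum_comm]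
  refine Finset.sum_congr rfl fun a _ => Finset.sum_congr rfl fun s' _ => ?_
  ring

lemma pushState_mem {d : S → ℝ} (hd : d ∈ stdSimplex ℝ S) (π : Policy S A) (q : Transition S A) :
    pushState d π q ∈ stdSimplex ℝ S := by
  refine ⟨fun s' => Finset.sum_nonneg fun s _ => mul_nonneg (hd.1 s) (Finset.sum_nonneg fun a _ =>
    mul_nonneg ((π.2 s).1 a) ((q.2 s a).1 s')), ?_⟩
  -- The total mass is read off from the constant test function 1.
  have h := sum_pushState_mul d π q fun _ => 1
  simp only [mul_one, (q.2 _ _).2, (π.2 _).2, hd.2] at h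
  exact h

lemma stateDist_mem (p : stdSimplex ℝ S) (pol : ℕ → Policy S A) (Q : ℕ → Transition S A) (t : ℕ) :
    stateDist p pol Q t ∈ stdSimplex ℝ S := by
  induction t with
  | zero => exact p.2
  | succ t ih => exact pushState_mem ih _ _

lemma stateActionPMF_apply (p : stdSimplex ℝ S) (π : Policy S A) (s : S) (a : A) :
    stateActionPMF p π (s, a) = ENNReal.ofReal (p.1 s) * ENNReal.ofReal (π.1 s a) := by
  classical
  rw [stateActionPMF, PMF.bind_apply, tsum_eq_single s, PMF.map_apply, tsum_eq_single a]
  · simp [simplexPMF]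
  · intro a' ha'
    simp [Ne.symm ha']
  · intro s' hs'
    rw [PMF.map_apply]
    simp [Ne.symm hs']

variable [MeasurableSpace S] [DiscreteMeasurableSpace S] [MeasurableSpace A]
  [DiscreteMeasurableSpace A]

lemma integral_stateActionPMF (p : stdSimplex ℝ S) (π : Policy S A) (f : S × A → ℝ) :
    ∫ x, f x ∂(stateActionPMF p π).toMeasure = ∑ s, p.1 s * ∑ a, π.1 s a * f (s, a) := by
  rw [PMF.integral_eq_sum, Fintype.sum_prod_type]
  refine Finset.sum_congr rfl fun s _ => ?_
  rw [Finset.mul_sum]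
  refine Finset.sum_congr rfl fun a _ => ?_
  rw [stateActionPMF_apply, ENNReal.toReal_mul, ENNReal.toReal_ofReal (p.2.1 s),
    ENNReal.toReal_ofReal ((π.2 s).1 a), smul_eq_mul, mul_assoc]

instance (p : stdSimplex ℝ S) (pol : ℕ → Policy S A) (Q : ℕ → Transition S A) :
    IsProbabilityMeasure (trajLaw p pol Q) := by
  unfold trajLaw
  infer_instance

lemma trajLaw_map_zero (p : stdSimplex ℝ S) (pol : ℕ → Policy S A) (Q : ℕ → Transition S A) :
    (trajLaw p pol Q).map (fun τ => τ 0) = (stateActionPMF p (pol 0)).toMeasure := by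
  -- Time 0 is read through the restriction to `Finset.Iic 0`, on which the partial trajectory
  -- kernel is the identity.
  have hf : (fun τ : ℕ → S × A => τ 0) =
      (fun x : (_i : Finset.Iic 0) → S × A => x ⟨0, Finset.mem_Iic.2 le_rfl⟩) ∘
        Preorder.frestrictLe (π := fun _ => S × A) 0 := rfl
  rw [hf, ← Measure.map_map (by fun_prop) (by fun_prop), trajLaw, Kernel.trajMeasure,
    Measure.map_comp _ _ (by fun_prop), Kernel.traj_map_frestrictLe, Kernel.partialTraj_self,
    Measure.id_comp, Measure.map_map (by fun_prop) (by fun_prop)]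
  exact Measure.map_id

lemma integrable_comp_coord (p : stdSimplex ℝ S) (pol : ℕ → Policy S A) (Q : ℕ → Transition S A)
    (t : ℕ) (f : S × A → ℝ) : Integrable (fun τ => f (τ t)) (trajLaw p pol Q) := by
  refine Integrable.of_bound (C := ∑ x, ‖f x‖) ?_ (Filter.Eventually.of_forall fun τ => ?_)
  · exact (measurable_of_countable f).comp (measurable_pi_apply t) |>.aestronglyMeasurable
  · exact Finset.single_le_sum (f := fun x => ‖f x‖) (fun x _ => norm_nonneg _)
      (Finset.mem_univ (τ t))

/-- The joint law of the history up to `t` and the next pair is the composition product with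
`stepKernel`, which depends on the history only through its last entry. -/
lemma integral_comp_coord_succ (p : stdSimplex ℝ S) (pol : ℕ → Policy S A)
    (Q : ℕ → Transition S A) (t : ℕ) (f : S × A → ℝ) :
    ∫ τ, f (τ (t + 1)) ∂(trajLaw p pol Q) =
      ∫ τ, ∑ s', (Q t).1 (τ t).1 (τ t).2 s' * ∑ a', (pol (t + 1)).1 s' a' * f (s', a')
        ∂(trajLaw p pol Q) := by
  have h := Kernel.map_frestrictLe_trajMeasure_compProd_eq_map_trajMeasure
    (X := fun _ => S × A) (μ₀ := (stateActionPMF p (pol 0)).toMeasure) (κ := stepKernel pol Q)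
    (a := t)
  have hfm : Measurable f := measurable_of_countable f
  have hprob : IsProbabilityMeasure
      ((trajLaw p pol Q).map (Preorder.frestrictLe (π := fun _ => S × A) t)) :=
    Measure.isProbabilityMeasure_map (by fun_prop)
  calc ∫ τ, f (τ (t + 1)) ∂(trajLaw p pol Q)
      = ∫ z, f z.2 ∂((trajLaw p pol Q).map (fun τ =>
          (Preorder.frestrictLe (π := fun _ => S × A) t τ, τ (t + 1)))) := by
        refine (integral_map (φ := fun τ : ℕ → S × A =>
          (Preorder.frestrictLe (π := fun _ => S × A) t τ, τ (t + 1)))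
          (f := fun z : ((_i : Finset.Iic t) → S × A) × (S × A) => f z.2) ?_ ?_).symm
        · exact Measurable.aemeasurable (by fun_prop)
        · exact (hfm.comp measurable_snd).aestronglyMeasurable
    _ = ∫ z, f z.2 ∂((trajLaw p pol Q).map (Preorder.frestrictLe (π := fun _ => S × A) t) ⊗ₘ
          stepKernel pol Q t) := by
        rw [trajLaw, ← h]
    _ = ∫ h, ∫ y, f y ∂(stepKernel pol Q t h)
          ∂((trajLaw p pol Q).map (Preorder.frestrictLe (π := fun _ => S × A) t)) := by
        rw [Measure.integral_compProd]
        refine Integrable.of_bound (C := ∑ x, ‖f x‖)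
          (hfm.comp measurable_snd).aestronglyMeasurable (Filter.Eventually.of_forall fun z => ?_)
        exact Finset.single_le_sum (f := fun x => ‖f x‖) (fun x _ => norm_nonneg _)
          (Finset.mem_univ z.2)
    _ = _ := by
        rw [integral_map (by fun_prop) (measurable_of_countable _).aestronglyMeasurable]
        refine integral_congr_ae (Filter.Eventually.of_forall fun τ => ?_)
        exact integral_stateActionPMF _ _ f

lemma integral_comp_coord (p : stdSimplex ℝ S) (pol : ℕ → Policy S A)
    (Q : ℕ → Transition S A) (t : ℕ) (f : S × A → ℝ) :
    ∫ τ, f (τ t) ∂(trajLaw p pol Q) =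
      ∑ s, stateDist p pol Q t s * ∑ a, (pol t).1 s a * f (s, a) := by
  -- The inductive step applies the hypothesis to the one-step conditional expectation of `f`, so
  -- `f` must vary.
  induction t generalizing f with
  | zero =>
    have hfm : Measurable f := measurable_of_countable f
    rw [← integral_stateActionPMF (⟨stateDist p pol Q 0, p.2⟩ : stdSimplex ℝ S),
      ← integral_map (φ := fun τ : ℕ → S × A => τ 0)
        (measurable_pi_apply 0).aemeasurable hfm.aestronglyMeasurable,
      trajLaw_map_zero]
    rfl
  | succ t ih =>
    rw [integral_comp_coord_succ, ih fun x => ∑ s', (Q t).1 x.1 x.2 s' *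
      ∑ a', (pol (t + 1)).1 s' a' * f (s', a')]
    exact (sum_pushState_mul _ _ _ _).symm

end Occupancy

/-! ### The infinite-horizon objective -/

lemma le_one_of_mem_stdSimplex {ι : Type*} [Fintype ι] {x : ι → ℝ} (hx : x ∈ stdSimplex ℝ ι)
    (i : ι) : x i ≤ 1 :=
  (Finset.single_le_sum (fun j _ => hx.1 j) (Finset.mem_univ i)).trans_eq hx.2

lemma stageReward_eq {S A : Type*} [Fintype A] (r : S → A → ℝ) (γ η : ℝ) (pol : ℕ → Policy S A)
    (τ : ℕ → S × A) (t : ℕ) :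
    stageReward r γ η pol τ t =
      γ ^ t * (r (τ t).1 (τ t).2 - η * Real.log ((pol t).1 (τ t).1 (τ t).2)) := by
  rw [stageReward]
  ring

section Horizon

variable {S A : Type*} [Fintype S] [Fintype A] {r : S → A → ℝ} {γ η : ℝ}

/-- The logarithm is unbounded near 0, but weighted by its own probability it satisfies `x * |log x|
≤ 1 - x ≤ 1`. -/
lemma mul_abs_sub_log_le (hη : 0 < η) {x : ℝ} (hx0 : 0 ≤ x) (hx1 : x ≤ 1) (c : ℝ) :
    x * |c - η * Real.log x| ≤ |c| + η := by
  have h1 : x * |η * Real.log x| ≤ η := by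
    rw [abs_mul, abs_of_pos hη, abs_of_nonpos (Real.log_nonpos hx0 hx1)]
    have h := Real.negMulLog_le_one_sub_self hx0
    rw [Real.negMulLog] at h
    have h2 := mul_le_mul_of_nonneg_left (h.trans (sub_le_self 1 hx0)) hη.le
    linarith
  calc x * |c - η * Real.log x| ≤ x * (|c| + |η * Real.log x|) :=
        mul_le_mul_of_nonneg_left (abs_sub _ _) hx0
    _ ≤ |c| + η := by
        rw [mul_add]
        exact add_le_add (mul_le_of_le_one_left (abs_nonneg _) hx1) h1

/-- The bound is uniform in policies, transitions and time; it supports both integrability of the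
series and its uniform convergence. -/
lemma stageMean_abs_le (hη : 0 < η) (p : stdSimplex ℝ S) (pol : ℕ → Policy S A)
    (Q : ℕ → Transition S A) (t : ℕ) :
    ∑ s, stateDist p pol Q t s *
      ∑ a, (pol t).1 s a * |r s a - η * Real.log ((pol t).1 s a)| ≤ ∑ s, ∑ a, (|r s a| + η) := by
  refine Finset.sum_le_sum fun s _ => ?_
  have hd := stateDist_mem p pol Q t
  refine (mul_le_of_le_one_left (Finset.sum_nonneg fun a _ =>
    mul_nonneg (((pol t).2 s).1 a) (abs_nonneg _)) (le_one_of_mem_stdSimplex hd s)).trans ?_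
  exact Finset.sum_le_sum fun a _ =>
    mul_abs_sub_log_le hη (((pol t).2 s).1 a) (le_one_of_mem_stdSimplex ((pol t).2 s) a) _

lemma abs_stageMean_le (hη : 0 < η) (p : stdSimplex ℝ S) (pol : ℕ → Policy S A)
    (Q : ℕ → Transition S A) (t : ℕ) : |stageMean r η p pol Q t| ≤ ∑ s, ∑ a, (|r s a| + η) := by
  refine le_trans ?_ (stageMean_abs_le hη p pol Q t)
  refine (Finset.abs_sum_le_sum_abs _ _).trans (Finset.sum_le_sum fun s _ => ?_)
  rw [abs_mul, abs_of_nonneg ((stateDist_mem p pol Q t).1 s)]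
  refine mul_le_mul_of_nonneg_left ?_ ((stateDist_mem p pol Q t).1 s)
  refine (Finset.abs_sum_le_sum_abs _ _).trans_eq (Finset.sum_congr rfl fun a _ => ?_)
  rw [abs_mul, abs_of_nonneg (((pol t).2 s).1 a)]

lemma norm_discounted_stageMean_le (hγ0 : 0 ≤ γ) (hη : 0 < η) (p : stdSimplex ℝ S)
    (pol : ℕ → Policy S A) (Q : ℕ → Transition S A) (t : ℕ) :
    ‖γ ^ t * stageMean r η p pol Q t‖ ≤ γ ^ t * ∑ s, ∑ a, (|r s a| + η) := by
  rw [norm_mul, Real.norm_eq_abs, Real.norm_eq_abs, abs_of_nonneg (pow_nonneg hγ0 t)]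
  exact mul_le_mul_of_nonneg_left (abs_stageMean_le hη p pol Q t) (pow_nonneg hγ0 t)

lemma summable_discounted_stageMean (hγ0 : 0 ≤ γ) (hγ1 : γ < 1) (hη : 0 < η)
    (p : stdSimplex ℝ S) (pol : ℕ → Policy S A) (Q : ℕ → Transition S A) :
    Summable fun t => γ ^ t * stageMean r η p pol Q t :=
  Summable.of_norm_bounded ((summable_geometric_of_lt_one hγ0 hγ1).mul_right _)
    (norm_discounted_stageMean_le hγ0 hη p pol Q)

/-! ### Continuity of finite-time quantities in the product topology. -/

lemma continuous_stateDist (p : stdSimplex ℝ S) (t : ℕ) (s : S) :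
    Continuous fun x : (ℕ → Policy S A) × (ℕ → Transition S A) => stateDist p x.1 x.2 t s := by
  induction t generalizing s with
  | zero => exact continuous_const
  | succ t ih =>
    simp only [stateDist, pushState]
    have h1 (s : S) (a : A) :
        Continuous fun x : (ℕ → Policy S A) × (ℕ → Transition S A) => (x.1 t).1 s a :=
      (continuous_apply_apply s a).comp
        (continuous_subtype_val.comp ((continuous_apply t).comp continuous_fst))
    have h2 (s : S) (a : A) (s' : S) :
        Continuous fun x : (ℕ → Policy S A) × (ℕ → Transition S A) => (x.2 t).1 s a s' :=
      (continuous_apply s').comp ((continuous_apply_apply s a).comp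
        (continuous_subtype_val.comp ((continuous_apply t).comp continuous_snd)))
    exact continuous_finsetSum _ fun s' _ => (ih s').mul
      (continuous_finsetSum _ fun a _ => (h1 s' a).mul (h2 s' a s))

lemma continuous_stageMean (p : stdSimplex ℝ S) (t : ℕ) :
    Continuous fun x : (ℕ → Policy S A) × (ℕ → Transition S A) =>
      stageMean r η p x.1 x.2 t := by
  have h1 (s : S) (a : A) :
      Continuous fun x : (ℕ → Policy S A) × (ℕ → Transition S A) => (x.1 t).1 s a :=
    (continuous_apply_apply s a).comp
      (continuous_subtype_val.comp ((continuous_apply t).comp continuous_fst))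
  have h2 (x : ℝ) (c : ℝ) : x * (c - η * Real.log x) = x * c + η * Real.negMulLog x := by
    rw [Real.negMulLog]
    ring
  unfold stageMean
  simp_rw [h2]
  exact continuous_finsetSum _ fun s _ => (continuous_stateDist p t s).mul
    (continuous_finsetSum _ fun a _ => ((h1 s a).mul continuous_const).add
      (continuous_const.mul (Real.continuous_negMulLog.comp (h1 s a))))

/-! ### The telescoping identity and the verification inequalities. -/

lemma stageMean_add_continuation (p : stdSimplex ℝ S) (pol : ℕ → Policy S A)
    (Q : ℕ → Transition S A) (V : S → ℝ) (t : ℕ) :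
    stageMean r η p pol Q t + γ * ∑ s, stateDist p pol Q (t + 1) s * V s =
      ∑ s, stateDist p pol Q t s * bellmanPsi r γ η V s (pol t) (Q t) := by
  rw [stateDist, sum_pushState_mul, stageMean, Finset.mul_sum, ← Finset.sum_add_distrib]
  refine Finset.sum_congr rfl fun s _ => ?_
  have h : bellmanPsi r γ η V s (pol t) (Q t) =
      ∑ a, (pol t).1 s a * (r s a - η * Real.log ((pol t).1 s a)) +
        γ * ∑ a, (pol t).1 s a * ∑ s', (Q t).1 s a s' * V s' := by
    rw [Finset.mul_sum, ← Finset.sum_add_distrib]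
    refine Finset.sum_congr rfl fun a _ => ?_
    ring
  rw [h]
  ring

/-- For an arbitrary `V`, the continuation value added at time `t` is the one subtracted at `t + 1`.
Only the initial value, a tail that vanishes as `n` grows, and the Bellman defects survive. -/
lemma sum_range_discounted_stageMean (p : stdSimplex ℝ S) (pol : ℕ → Policy S A)
    (Q : ℕ → Transition S A) (V : S → ℝ) (n : ℕ) :
    ∑ t ∈ Finset.range n, γ ^ t * stageMean r η p pol Q t =
      ∑ s, p.1 s * V s - γ ^ n * ∑ s, stateDist p pol Q n s * V s +
        ∑ t ∈ Finset.range n, γ ^ t * ∑ s, stateDist p pol Q t s *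
          (bellmanPsi r γ η V s (pol t) (Q t) - V s) := by
  induction n with
  | zero => simp [stateDist]
  | succ n ih =>
    have h := stageMean_add_continuation (r := r) (γ := γ) (η := η) p pol Q V n
    simp only [mul_sub, Finset.sum_sub_distrib] at ih ⊢
    rw [Finset.sum_range_succ, Finset.sum_range_succ, Finset.sum_range_succ, ih, ← h, pow_succ]
    ring

lemma abs_sum_simplex_mul_le {d : S → ℝ} (hd : d ∈ stdSimplex ℝ S) (V : S → ℝ) :
    |∑ s, d s * V s| ≤ ‖V‖ := by
  calc |∑ s, d s * V s| ≤ ∑ s, d s * ‖V‖ := by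
        refine (Finset.abs_sum_le_sum_abs _ _).trans (Finset.sum_le_sum fun s _ => ?_)
        rw [abs_mul, abs_of_nonneg (hd.1 s)]
        exact mul_le_mul_of_nonneg_left (norm_le_pi_norm V s) (hd.1 s)
    _ = ‖V‖ := by rw [← Finset.sum_mul, hd.2, one_mul]

lemma tendsto_discounted_sum_stateDist (hγ0 : 0 ≤ γ) (hγ1 : γ < 1) (p : stdSimplex ℝ S)
    (pol : ℕ → Policy S A) (Q : ℕ → Transition S A) (V : S → ℝ) :
    Filter.Tendsto (fun n => γ ^ n * ∑ s, stateDist p pol Q n s * V s) Filter.atTop (nhds 0) := by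
  have h : Filter.Tendsto (fun n => γ ^ n * ‖V‖) Filter.atTop (nhds 0) := by
    simpa using (tendsto_pow_atTop_nhds_zero_of_lt_one hγ0 hγ1).mul_const ‖V‖
  refine squeeze_zero_norm (fun n => ?_) h
  rw [norm_mul, Real.norm_eq_abs, Real.norm_eq_abs, abs_of_nonneg (pow_nonneg hγ0 n)]
  exact mul_le_mul_of_nonneg_left (abs_sum_simplex_mul_le (stateDist_mem p pol Q n) V)
    (pow_nonneg hγ0 n)

lemma tsum_discounted_stageMean_le (hγ0 : 0 ≤ γ) (hγ1 : γ < 1) (hη : 0 < η) (p : stdSimplex ℝ S)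
    (pol : ℕ → Policy S A) (Q : ℕ → Transition S A) (V : S → ℝ)
    (h : ∀ t s, bellmanPsi r γ η V s (pol t) (Q t) ≤ V s) :
    ∑' t, γ ^ t * stageMean r η p pol Q t ≤ ∑ s, p.1 s * V s := by
  have hlim := (summable_discounted_stageMean (r := r) hγ0 hγ1 hη p pol Q).hasSum.tendsto_sum_nat
  have hlim' := (tendsto_discounted_sum_stateDist hγ0 hγ1 p pol Q V).const_sub (∑ s, p.1 s * V s)
  rw [sub_zero] at hlim'
  refine le_of_tendsto_of_tendsto' hlim hlim' fun n => ?_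
  rw [sum_range_discounted_stageMean p pol Q V n]
  refine add_le_of_nonpos_right (Finset.sum_nonpos fun t _ =>
    mul_nonpos_of_nonneg_of_nonpos (pow_nonneg hγ0 t) (Finset.sum_nonpos fun s _ =>
      mul_nonpos_of_nonneg_of_nonpos ((stateDist_mem p pol Q t).1 s) (sub_nonpos.2 (h t s))))

lemma le_tsum_discounted_stageMean (hγ0 : 0 ≤ γ) (hγ1 : γ < 1) (hη : 0 < η) (p : stdSimplex ℝ S)
    (pol : ℕ → Policy S A) (Q : ℕ → Transition S A) (V : S → ℝ)
    (h : ∀ t s, V s ≤ bellmanPsi r γ η V s (pol t) (Q t)) :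
    ∑ s, p.1 s * V s ≤ ∑' t, γ ^ t * stageMean r η p pol Q t := by
  have hlim := (summable_discounted_stageMean (r := r) hγ0 hγ1 hη p pol Q).hasSum.tendsto_sum_nat
  have hlim' := (tendsto_discounted_sum_stateDist hγ0 hγ1 p pol Q V).const_sub (∑ s, p.1 s * V s)
  rw [sub_zero] at hlim'
  refine le_of_tendsto_of_tendsto' hlim' hlim fun n => ?_
  rw [sum_range_discounted_stageMean p pol Q V n]
  exact le_add_of_nonneg_right (Finset.sum_nonneg fun t _ => mul_nonneg (pow_nonneg hγ0 t)
    (Finset.sum_nonneg fun s _ => mul_nonneg ((stateDist_mem p pol Q t).1 s)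
      (sub_nonneg.2 (h t s))))

/-! ### From the trajectory law to the discounted series, and the infinite-horizon saddle point. -/

variable [MeasurableSpace S] [DiscreteMeasurableSpace S] [MeasurableSpace A]
  [DiscreteMeasurableSpace A]

lemma integrable_stageReward (p : stdSimplex ℝ S) (pol : ℕ → Policy S A)
    (Q : ℕ → Transition S A) (t : ℕ) :
    Integrable (fun τ => stageReward r γ η pol τ t) (trajLaw p pol Q) := by
  simp_rw [stageReward_eq]
  exact (integrable_comp_coord p pol Q t
    fun x => r x.1 x.2 - η * Real.log ((pol t).1 x.1 x.2)).const_mul _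

lemma integral_stageReward (p : stdSimplex ℝ S) (pol : ℕ → Policy S A)
    (Q : ℕ → Transition S A) (t : ℕ) :
    ∫ τ, stageReward r γ η pol τ t ∂(trajLaw p pol Q) = γ ^ t * stageMean r η p pol Q t := by
  simp_rw [stageReward_eq]
  rw [integral_const_mul,
    integral_comp_coord p pol Q t fun x => r x.1 x.2 - η * Real.log ((pol t).1 x.1 x.2)]
  rfl

lemma summable_integral_norm_stageReward (hγ0 : 0 ≤ γ) (hγ1 : γ < 1) (hη : 0 < η)
    (p : stdSimplex ℝ S) (pol : ℕ → Policy S A) (Q : ℕ → Transition S A) :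
    Summable fun t => ∫ τ, ‖stageReward r γ η pol τ t‖ ∂(trajLaw p pol Q) := by
  refine Summable.of_nonneg_of_le (fun t => integral_nonneg fun τ => norm_nonneg _) (fun t => ?_)
    ((summable_geometric_of_lt_one hγ0 hγ1).mul_right (∑ s, ∑ a, (|r s a| + η)))
  simp_rw [stageReward_eq, norm_mul, Real.norm_eq_abs, abs_of_nonneg (pow_nonneg hγ0 t)]
  rw [integral_const_mul,
    integral_comp_coord p pol Q t fun x => |r x.1 x.2 - η * Real.log ((pol t).1 x.1 x.2)|]
  exact mul_le_mul_of_nonneg_left (stageMean_abs_le hη p pol Q t) (pow_nonneg hγ0 t)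

lemma expReward_eq_tsum (hγ0 : 0 ≤ γ) (hγ1 : γ < 1) (hη : 0 < η)
    (p : stdSimplex ℝ S) (pol : ℕ → Policy S A) (Q : ℕ → Transition S A) :
    expReward r γ η p pol Q = ∑' t, γ ^ t * stageMean r η p pol Q t := by
  rw [expReward, ← integral_tsum_of_summable_integral_norm (integrable_stageReward p pol Q)
    (summable_integral_norm_stageReward hγ0 hγ1 hη p pol Q)]
  simp_rw [integral_stageReward]

/-- Weierstrass M-test with a geometric majorant independent of both sequences. -/
lemma continuous_expReward (hγ0 : 0 ≤ γ) (hγ1 : γ < 1) (hη : 0 < η) (p : stdSimplex ℝ S) :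
    Continuous (Function.uncurry (expReward (A := A) r γ η p)) := by
  have h : Function.uncurry (expReward (A := A) r γ η p) =
      fun x => ∑' t, γ ^ t * stageMean r η p x.1 x.2 t :=
    funext fun x => expReward_eq_tsum hγ0 hγ1 hη p x.1 x.2
  rw [h]
  exact continuous_tsum (fun t => continuous_const.mul (continuous_stageMean p t))
    ((summable_geometric_of_lt_one hγ0 hγ1).mul_right _)
    fun t x => norm_discounted_stageMean_le hγ0 hη p x.1 x.2 t

/-- A stationary pair that is a saddle point of every one-stage problem for its own value function
is a saddle point of the infinite-horizon problem. -/
lemma isSaddle_expReward (hγ0 : 0 ≤ γ) (hγ1 : γ < 1) (hη : 0 < η) (p : stdSimplex ℝ S)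
    {𝒬 : Set (Transition S A)} {V : S → ℝ} {π : Policy S A} {q : Transition S A}
    (hq : q ∈ 𝒬) (h : ∀ s, IsSaddle (bellmanPsi r γ η V s) 𝒬 π q)
    (hV : ∀ s, bellmanPsi r γ η V s π q = V s) :
    IsSaddle (expReward r γ η p) (adversarySeq 𝒬) (fun _ => π) (fun _ => q) ∧
      expReward r γ η p (fun _ => π) (fun _ => q) = ∑ s, p.1 s * V s := by
  have hle (pol : ℕ → Policy S A) : expReward r γ η p pol (fun _ => q) ≤ ∑ s, p.1 s * V s := by
    rw [expReward_eq_tsum hγ0 hγ1 hη]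
    exact tsum_discounted_stageMean_le hγ0 hγ1 hη p _ _ V fun t s =>
      ((h s).2.1 (pol t)).trans_eq (hV s)
  have hge (Q : ℕ → Transition S A) (hQ : Q ∈ adversarySeq 𝒬) :
      ∑ s, p.1 s * V s ≤ expReward r γ η p (fun _ => π) Q := by
    rw [expReward_eq_tsum hγ0 hγ1 hη]
    exact le_tsum_discounted_stageMean hγ0 hγ1 hη p _ _ V fun t s =>
      (hV s).symm.trans_le ((h s).2.2 (Q t) (hQ t))
  have hmem : (fun _ => q) ∈ adversarySeq 𝒬 := fun _ => hq
  have heq := (hle fun _ => π).antisymm (hge _ hmem)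
  exact ⟨⟨hmem, fun pol => (hle pol).trans_eq heq.symm,
    fun Q hQ => heq.trans_le (hge Q hQ)⟩, heq⟩

end Horizon

theorem theorem2 {S A : Type*} [Fintype S] [Fintype A] [Nonempty A]
    [MeasurableSpace S] [DiscreteMeasurableSpace S]
    [MeasurableSpace A] [DiscreteMeasurableSpace A]
    (r : S → A → ℝ) (γ η : ℝ) (hγ0 : 0 ≤ γ) (hγ1 : γ < 1) (hη : 0 < η)
    (𝒬 : Set (Transition S A)) (Qs : S → Set (A → S → ℝ)) (hne : 𝒬.Nonempty)
    (hrect : IsSRectangular 𝒬 Qs)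
    (hcompact : ∀ s, IsCompact (Qs s)) (hconvex : ∀ s, Convex ℝ (Qs s)) :
    -- the infinite-horizon objective is well defined
    (∀ (p : stdSimplex ℝ S) (pol : ℕ → Policy S A) (Q : ℕ → Transition S A),
      (∀ᵐ τ ∂(trajLaw p pol Q), Summable (stageReward r γ η pol τ)) ∧
      Integrable (fun τ => ∑' t, stageReward r γ η pol τ t) (trajLaw p pol Q)) ∧
    -- perfect duality for the robust Bellman operator `T`
    (∀ V s, IsMaxMin (bellmanPsi r γ η V s) 𝒬 (robustBellman r γ η 𝒬 V s) ∧
      IsMinMax (bellmanPsi r γ η V s) 𝒬 (robustBellman r γ η 𝒬 V s)) ∧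
    -- `T` is a contraction of parameter `γ` in the sup-norm
    (∀ V W, ‖robustBellman r γ η 𝒬 V - robustBellman r γ η 𝒬 W‖ ≤ γ * ‖V - W‖) ∧
    -- the inner problem is convex and has a solution
    (∀ V s, ConvexOn ℝ (Qs s) (expSum r γ η V s)) ∧
    (∀ V, ∃ q, IsWorstCase r γ η 𝒬 Qs V q) ∧
    -- closed form of `T` through any solution of the inner problem
    (∀ V q, IsWorstCase r γ η 𝒬 Qs V q →
      robustBellman r γ η 𝒬 V = softBellman r γ η q V) ∧
    -- the unique fixed point `V*`
    ∃ Vs : S → ℝ,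
      (∀ V, robustBellman r γ η 𝒬 V = V ↔ V = Vs) ∧
      ∀ qs, IsWorstCase r γ η 𝒬 Qs Vs qs →
        -- the mapping with `q*` held fixed is a contraction with the same unique fixed point
        (∀ V W, ‖softBellman r γ η qs V - softBellman r γ η qs W‖ ≤ γ * ‖V - W‖) ∧
        (∀ V, softBellman r γ η qs V = V ↔ V = Vs) ∧
        -- `(π*, q*)` is a saddle point of the one-stage problem in every state, of value `V*(s)`
        (∀ s, IsSaddle (bellmanPsi r γ η Vs s) 𝒬 (softmaxPolicy r γ η Vs qs) qs ∧
          bellmanPsi r γ η Vs s (softmaxPolicy r γ η Vs qs) qs = Vs s) ∧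
        -- for every initial distribution, `π*` is robust optimal, perfect duality holds, and
        -- `(π*, q*)` is a saddle point of the infinite-horizon problem
        (∀ p : stdSimplex ℝ S,
          IsMaxMinAt (expReward r γ η p) (adversarySeq 𝒬)
            (fun _ => softmaxPolicy r γ η Vs qs) (∑ s, p.1 s * Vs s) ∧
          IsMinMaxAt (expReward r γ η p) (adversarySeq 𝒬)
            (fun _ => qs) (∑ s, p.1 s * Vs s) ∧
          IsSaddle (expReward r γ η p) (adversarySeq 𝒬)
            (fun _ => softmaxPolicy r γ η Vs qs) (fun _ => qs)) := by
  have hcontr := norm_sub_le_of_le_add (T := robustBellman r γ η 𝒬) hγ0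
    (robustBellman_le_add hγ0 hη hne hrect hcompact hconvex)
  refine ⟨fun p pol Q => ae_summable_and_integrable_tsum (integrable_stageReward p pol Q)
      (summable_integral_norm_stageReward hγ0 hγ1 hη p pol Q), fun V s => ?_, hcontr,
    fun V s => convexOn_expSum V s (hconvex s), exists_isWorstCase hne hrect hcompact,
    fun V q hq => hq.robustBellman_eq hη hrect hcompact hconvex, ?_⟩
  · obtain ⟨q, hq⟩ := exists_isWorstCase (r := r) (γ := γ) (η := η) hne hrect hcompact V
    rw [hq.robustBellman_eq hη hrect hcompact hconvex]
    exact ⟨⟨_, hq.isMaxMinAt_bellmanPsi hη hrect hcompact hconvex s⟩,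
      ⟨_, hq.isMinMaxAt_bellmanPsi hη hrect hconvex s⟩⟩
  · obtain ⟨Vs, hVs⟩ := exists_fixedPoint_iff hγ0 hγ1 hcontr
    refine ⟨Vs, hVs, fun qs hqs => ?_⟩
    have hsoft := norm_sub_le_of_le_add (T := softBellman r γ η qs) hγ0
      (softBellman_le_add hγ0 hη qs)
    -- The transition `qs` is worst-case at `Vs`, so the robust and soft operators agree at this
    -- point; agreement elsewhere is not needed.
    have hfix : softBellman r γ η qs Vs = Vs :=
      (hqs.robustBellman_eq hη hrect hcompact hconvex).symm.trans ((hVs Vs).2 rfl)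
    have hsaddle := hqs.isSaddle_bellmanPsi hη hrect hconvex
    have hval (s : S) : bellmanPsi r γ η Vs s (softmaxPolicy r γ η Vs qs) qs = Vs s :=
      (bellmanPsi_softmaxPolicy hη Vs s qs).trans (congrFun hfix s)
    refine ⟨hsoft, fun V => ?_, fun s => ⟨hsaddle s, hval s⟩, fun p => ?_⟩
    -- The soft operator has a single fixed point `W`; since `Vs` is fixed, it must be `W`.
    · obtain ⟨W, hW⟩ := exists_fixedPoint_iff hγ0 hγ1 hsoft
      rw [hW, (hW Vs).1 hfix]
    · obtain ⟨hs, hv⟩ := isSaddle_expReward hγ0 hγ1 hη p hqs.1 hsaddle hval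
      have hmaxmin := hs.isMaxMinAt (isCompact_adversarySeq (hrect.isCompact hcompact))
        fun pol => (continuous_expReward hγ0 hγ1 hη p).uncurry_left pol
      have hminmax := hs.isMinMaxAt
        fun Q => (continuous_expReward hγ0 hγ1 hη p).uncurry_right Q
      rw [hv] at hmaxmin hminmax
      exact ⟨hmaxmin, hminmax, hs⟩
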